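/- For $\tau$ in the upper half-plane $\mathfrak H$ let $\theta_2(\tau)=\sum_{n\in\mathbb Z}e^{\pi i(n+1/2)^2\tau}$, $\theta_3(\tau)=\sum_{n\in\mathbb Z}e^{\pi i n^2\tau}$, and let $\lambda=\theta_2^4/\theta_3^4$ be the elliptic modular function, a Hauptmodul for $\Gamma(2)$. Let $E_4(\tau)=1+240\sum_{n\ge1}\sigma_3(n)e^{2\pi i n\tau}$ be the Eisenstein series of weight $4$, and let $\{f,\tau\}=\frac{f'''}{f'}-\frac32\left(\frac{f''}{f'}\right)^2$ denote the Schwarz derivative of a meromorphic function $f$. Then the meromorphic function on $\mathfrak H$ $$h=\frac{\lambda^3(\lambda-2)}{\lambda^4-2\lambda^3+4\lambda-2}$$ satisfies $$\{h,\tau\}=2\pi^2\left(\tfrac32\right)^2E_4(\tau)$$ as an identity of meromorphic functions on $\mathfrak H$. More precisely, at each $\tau\in\mathfrak H$ with $\lambda^4-2\lambda^3+4\lambda-2\neq0$ the function $h$ is holomorphic, $h'(\tau)\ne0$, and the equation holds; at every point of $\mathfrak H$, in particular at each pole of $h$, the function $\{h,\cdot\}$ has a limit, equal to the right-hand side. This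 is the case $(m,n,d)=(2,3,4)$ of the equation $\{h,\tau\}=2\pi^2(n/m)^2E_4$, where $m=2$ is the level: an element $\gamma\in \mathrm{SL}_2(\mathbb Z)$ satisfies $h(\gamma\tau)=h(\tau)$ for all $\tau$ if and only if $\gamma\in\Gamma(2)$; and $d=4$ is the degree of $h$ as a rational function of $\lambda$: the numerator $t^3(t-2)$ and the denominator $t^4-2t^3+4t-2$ are coprime and the larger of their degrees is $4$. -/

import Mathlib

noncomputable section

namespace SchwarzLambda

/-- The Schwarz derivative `{f, z} = f''' / f' - (3/2) (f'' / f')²`. -/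
def schwarzian (f : ℂ → ℂ) (z : ℂ) : ℂ :=
  iteratedDeriv 3 f z / deriv f z - 3 / 2 * (iteratedDeriv 2 f z / deriv f z) ^ 2

/-- The theta constant `θ₂(τ) = ∑_{n ∈ ℤ} exp (π i (n + 1/2)² τ)`. -/
def theta2 (τ : ℂ) : ℂ :=
  ∑' n : ℤ, Complex.exp (Real.pi * Complex.I * ((n : ℂ) + 1 / 2) ^ 2 * τ)

/-- The theta constant `θ₃(τ) = ∑_{n ∈ ℤ} exp (π i n² τ)`. -/
def theta3 (τ : ℂ) : ℂ := jacobiTheta τ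

/-- The elliptic modular function `λ = θ₂⁴ / θ₃⁴` (meaningful on the upper half-plane). -/
def modularLambda (τ : ℂ) : ℂ := theta2 τ ^ 4 / theta3 τ ^ 4

open Polynomial in
/-- The numerator `t³ (t - 2)`. -/
def numPoly : ℂ[X] := X ^ 3 * (X - 2)

open Polynomial in
/-- The denominator `t⁴ - 2 t³ + 4 t - 2`. -/
def denPoly : ℂ[X] := X ^ 4 - 2 * X ^ 3 + 4 * X - 2

/-- `h = λ³ (λ - 2) / (λ⁴ - 2 λ³ + 4 λ - 2)`. At the zeros of the denominator, where `h` has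
poles, the value is the conventional `0`. -/
def h (τ : ℂ) : ℂ :=
  numPoly.eval (modularLambda τ) / denPoly.eval (modularLambda τ)

end SchwarzLambda

end

namespace SchwarzLambda

open UpperHalfPlane hiding I
open Complex ModularGroup ModularForm Filter Asymptotics EisensteinSeries
open Derivative
open scoped Real MatrixGroups Manifold Topology

/-! ### Level one modular forms -/

/-! Write a, b, c for θ₂⁴, θ₃⁴, θ₄⁴, so that b = a + c. Multiplying through by θ₃¹⁶ gives h = N/Q
with N, Q quartic forms in a and c. The rational function of λ has dh/dλ = 12λ²(λ-1)²/denPoly(λ)²,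
so it ramifies only over the cusp values 0, 1, ∞, each with index 3. Hence h' = 12πi(abc)³/Q² never
vanishes on ℍ, and the exponent 3/2 appears because λ has order 1/2 in e^{2πiτ} at the cusp.

The Schwarz derivative is computed through a Riccati equation: with φ = h''/h' one has {h,τ} = φ' -
φ²/2 (`schwarzian_eq_of_riccati`). Everything lives in the ring generated by a, c, E₂, which is
closed under differentiation: a' and c' come from `thetaDefect_eq_zero`, E₂' from Ramanujan's
equation `normalizedDeriv_E2`, and E₄ = a² + ac + c². There φ = (πi/3)(E₂ - 2ψ/Q), where ψ is the
Serre derivative of Q up to a constant. The Riccati equation reduces to the fact that the Serre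
derivative of ψ, in the same normalization, is 20·E₄·Q (`hasDerivAt_thetaLogDeriv`).

The identities between theta constants all rest on one principle: a level one cusp form of weight
below 12 is zero (`eq_zero_of_weight_lt_twelve`). S and T permute a, b, c up to sign and weight
factor, so suitable symmetric combinations have level one.

For the level, SL₂(ℤ) permutes a, c, -b through SL₂(𝔽₂), so h∘γ is one of six functions. Limits at
i∞ separate h from four of the other five; the fifth, h∘T, equals -h. -/

lemma slash_S_apply (k : ℤ) (f : ℍ → ℂ) (τ : ℍ) :
    (f ∣[k] S) τ = f (S • τ) * (τ : ℂ) ^ (-k) := by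
  rw [SL_slash_apply]
  simp [denom_S]

lemma slash_T_apply (k : ℤ) (f : ℍ → ℂ) (τ : ℍ) : (f ∣[k] T) τ = f (T • τ) := by
  rw [SL_slash_apply]
  have : denom (T : SL(2, ℤ)) (τ : ℂ) = 1 := by
    rw [ModularGroup.denom_apply]
    simp [ModularGroup.T]
  rw [this]
  simp

lemma apply_S_of_slash {k : ℤ} {f g : ℍ → ℂ} (hfg : f ∣[k] S = g) (τ : ℍ) :
    f (S • τ) = (τ : ℂ) ^ k * g τ := by
  rw [← hfg, slash_S_apply, mul_left_comm, ← zpow_add₀ τ.ne_zero]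
  simp

lemma slash_S_eq {k : ℤ} {f g : ℍ → ℂ} (hfg : ∀ τ : ℍ, f (S • τ) = (τ : ℂ) ^ k * g τ) :
    f ∣[k] S = g := by
  ext τ
  rw [slash_S_apply, hfg, mul_right_comm, ← zpow_add₀ τ.ne_zero]
  simp

lemma slash_T_eq {k : ℤ} {f g : ℍ → ℂ} (hfg : ∀ τ : ℍ, f (T • τ) = g τ) : f ∣[k] T = g := by
  ext τ
  rw [slash_T_apply, hfg]

/-- The cusp form of level one attached to a holomorphic function that transforms correctly
under `S` and `T` and tends to zero at `i∞`. -/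
def cuspFormOfGenerators {k : ℤ} (f : ℍ → ℂ) (hf : MDiff f)
    (hS : ∀ τ : ℍ, f (S • τ) = (τ : ℂ) ^ k * f τ) (hT : ∀ τ : ℍ, f (T • τ) = f τ)
    (h0 : Tendsto f atImInfty (𝓝 0)) : CuspForm 𝒮ℒ k where
  toFun := f
  slash_action_eq' A hA := by
    obtain ⟨A, rfl⟩ := hA
    exact SlashInvariantForm.slash_action_generators_SL2Z (slash_S_eq hS) (slash_T_eq hT) A
  holo' := hf
  zero_at_cusps' hc := by
    rw [Subgroup.IsArithmetic.isCusp_iff_isCusp_SL2Z] at hc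
    rw [OnePoint.isZeroAt_iff_forall_SL2Z hc]
    intro γ _
    rw [SlashInvariantForm.slash_action_generators_SL2Z (slash_S_eq hS) (slash_T_eq hT)]
    exact h0

/-- There are no nonzero level one cusp forms of weight less than twelve. -/
lemma eq_zero_of_weight_lt_twelve {k : ℤ} (hk : k < 12) {f : ℍ → ℂ} (hf : MDiff f)
    (hS : ∀ τ : ℍ, f (S • τ) = (τ : ℂ) ^ k * f τ) (hT : ∀ τ : ℍ, f (T • τ) = f τ)
    (h0 : Tendsto f atImInfty (𝓝 0)) (τ : ℍ) : f τ = 0 := by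
  have := rank_zero_iff_forall_zero.mp (CuspForm.rank_eq_zero_of_weight_lt_twelve hk)
    (cuspFormOfGenerators f hf hS hT h0)
  exact congrArg (fun g : CuspForm 𝒮ℒ k ↦ g τ) this

lemma discriminant_apply_S (τ : ℍ) :
    discriminant (S • τ) = (τ : ℂ) ^ 12 * discriminant τ := by
  have := apply_S_of_slash discriminant_S_invariant τ
  exact_mod_cast this

lemma discriminant_apply_T (τ : ℍ) : discriminant (T • τ) = discriminant τ := by
  rw [← slash_T_apply 12 discriminant, discriminant_T_invariant]

lemma mdifferentiable_discriminant : MDiff discriminant := CuspForm.discriminant.holo'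

/-! ### Theta constants -/

/-- The theta constant `θ₄(τ) = ∑_{n ∈ ℤ} (-1)ⁿ exp (π i n² τ)`. -/
noncomputable def theta4 (τ : ℂ) : ℂ := jacobiTheta (τ + 1)

lemma summable_exp_sq {τ : ℂ} (hτ : 0 < τ.im) :
    Summable fun n : ℤ ↦ cexp (π * I * (n : ℂ) ^ 2 * τ) := by
  have := (summable_jacobiTheta₂_term_iff 0 τ).mpr hτ
  simpa [jacobiTheta₂_term] using this

lemma hasSum_int_even_add_odd {f : ℤ → ℂ} {a b : ℂ} (he : HasSum (fun n ↦ f (2 * n)) a)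
    (ho : HasSum (fun n ↦ f (2 * n + 1)) b) : HasSum f (a + b) := by
  have hinj : Function.Injective fun n : ℤ ↦ 2 * n := mul_right_injective₀ two_ne_zero
  have hinj' : Function.Injective fun n : ℤ ↦ 2 * n + 1 := (add_left_injective 1).comp hinj
  refine (hinj.hasSum_range_iff.2 he).add_isCompl ?_ (hinj'.hasSum_range_iff.2 ho)
  simpa using Int.isCompl_even_odd

/-- Splitting the series of θ₃(τ/4) by parity, the even terms give θ₃(τ) and the odd ones θ₂(τ).
Holomorphy and the limit at i∞ of θ₂ are thereby inherited from θ₃. -/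
lemma theta2_eq_sub {τ : ℂ} (hτ : 0 < τ.im) : theta2 τ = theta3 (τ / 4) - theta3 τ := by
  have h4 : 0 < (τ / 4).im := by
    rw [show τ / 4 = τ / (4 : ℝ) by norm_num, Complex.div_ofReal_im]; positivity
  have hs := summable_exp_sq h4
  have heven : Summable fun n : ℤ ↦ cexp (π * I * ((2 * n : ℤ) : ℂ) ^ 2 * (τ / 4)) :=
    hs.comp_injective (i := fun n : ℤ ↦ 2 * n) (fun a b hab ↦ by simpa using hab)
  have hodd : Summable fun n : ℤ ↦ cexp (π * I * ((2 * n + 1 : ℤ) : ℂ) ^ 2 * (τ / 4)) :=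
    hs.comp_injective (i := fun n : ℤ ↦ 2 * n + 1) (fun a b hab ↦ by simpa using hab)
  have := hasSum_int_even_add_odd (f := fun n : ℤ ↦ cexp (π * I * (n : ℂ) ^ 2 * (τ / 4)))
    heven.hasSum hodd.hasSum
  have key : theta3 (τ / 4) = theta3 τ + theta2 τ := by
    unfold theta3 theta2 jacobiTheta
    rw [this.tsum_eq]
    congr 1 <;> refine tsum_congr fun n ↦ ?_ <;> congr 1 <;> push_cast <;> ring
  rw [key]; ring

lemma theta2_add_one (τ : ℂ) : theta2 (τ + 1) = cexp (π * I / 4) * theta2 τ := by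
  unfold theta2
  rw [← tsum_mul_left]
  refine tsum_congr fun n ↦ ?_
  -- (n + 1/2)² = n(n + 1) + 1/4 with n(n + 1) even, so every term picks up the same factor.
  obtain ⟨m, hm⟩ := Int.even_mul_succ_self n
  have hm' : (n : ℂ) * (n + 1) = m + m := by exact_mod_cast hm
  rw [← Complex.exp_add, show (π * I * ((n : ℂ) + 1 / 2) ^ 2 * (τ + 1) : ℂ) =
    π * I / 4 + π * I * ((n : ℂ) + 1 / 2) ^ 2 * τ + m * (2 * π * I) by
      linear_combination (π * I) * hm', Complex.exp_add, Complex.exp_int_mul_two_pi_mul_I, mul_one]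

lemma theta2_pow_add_one (τ : ℂ) : theta2 (τ + 1) ^ 4 = -theta2 τ ^ 4 := by
  rw [theta2_add_one, mul_pow, ← Complex.exp_nat_mul,
    show ((4 : ℕ) : ℂ) * (π * I / 4) = π * I by push_cast; ring, Complex.exp_pi_mul_I]
  ring

lemma theta4_add_one (τ : ℂ) : theta4 (τ + 1) = theta3 τ := by
  rw [theta4, theta3, ← jacobiTheta_two_add τ]
  congr 1; ring

lemma theta4_eq_jacobiTheta₂ (τ : ℂ) : theta4 τ = jacobiTheta₂ (1 / 2) τ := by
  unfold theta4 jacobiTheta jacobiTheta₂ jacobiTheta₂_term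
  refine tsum_congr fun n ↦ ?_
  obtain ⟨m, hm⟩ := Int.even_mul_succ_self (n - 1)
  have hm' : ((n : ℂ) - 1) * n = m + m := by
    have : ((n - 1 : ℤ) : ℂ) * ((n - 1 : ℤ) + 1) = m + m := by exact_mod_cast hm
    push_cast at this
    linear_combination this
  rw [show (π * I * (n : ℂ) ^ 2 * (τ + 1) : ℂ) =
    2 * π * I * n * (1 / 2) + π * I * n ^ 2 * τ + m * (2 * π * I) by
      linear_combination (π * I) * hm', Complex.exp_add, Complex.exp_int_mul_two_pi_mul_I, mul_one]

lemma theta2_eq_jacobiTheta₂ (τ : ℂ) :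
    theta2 τ = cexp (π * I * τ / 4) * jacobiTheta₂ (τ / 2) τ := by
  unfold theta2 jacobiTheta₂ jacobiTheta₂_term
  rw [← tsum_mul_left]
  refine tsum_congr fun n ↦ ?_
  rw [← Complex.exp_add]
  congr 1; ring

/-- The fourth power removes the branch of the square root from the theta inversion formulas, which
is why θ⁴ is used throughout. -/
lemma cpow_half_pow_four (τ : ℂ) : ((-I * τ) ^ (1 / 2 : ℂ)) ^ 4 = -τ ^ 2 := by
  rw [← Complex.cpow_nat_mul]
  norm_num [mul_pow]

lemma theta3_pow_S (τ : ℍ) : theta3 (S • τ : ℍ) ^ 4 = -(τ : ℂ) ^ 2 * theta3 τ ^ 4 := by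
  rw [theta3, jacobiTheta_S_smul, mul_pow, cpow_half_pow_four, theta3]

lemma coe_S_smul (τ : ℍ) : ((S • τ : ℍ) : ℂ) = -1 / τ := by
  rw [modular_S_smul]
  rw [UpperHalfPlane.coe_mk, neg_div, one_div, inv_neg]

lemma coe_T_smul (τ : ℍ) : ((T • τ : ℍ) : ℂ) = τ + 1 := by
  rw [modular_T_smul]
  simp [add_comm]

lemma theta2_pow_S (τ : ℍ) : theta2 (S • τ : ℍ) ^ 4 = -(τ : ℂ) ^ 2 * theta4 τ ^ 4 := by
  have h0 : (τ : ℂ) ≠ 0 := τ.ne_zero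
  have h1 : (-I * τ : ℂ) ^ (1 / 2 : ℂ) ≠ 0 := by
    rw [Ne, cpow_eq_zero_iff, not_and_or]
    exact Or.inl <| mul_ne_zero (neg_ne_zero.mpr I_ne_zero) h0
  -- This is the functional equation of the two-variable theta function at the point 1/2.
  have key : theta2 (S • τ : ℍ) = (-I * τ : ℂ) ^ (1 / 2 : ℂ) * theta4 τ := by
    rw [theta4_eq_jacobiTheta₂, jacobiTheta₂_functional_equation, theta2_eq_jacobiTheta₂,
      coe_S_smul, ← jacobiTheta₂_neg_left]
    rw [show -(-1 / (τ : ℂ) / 2) = 1 / 2 / τ by field_simp,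
      show π * I * (-1 / (τ : ℂ)) / 4 = -π * I * (1 / 2) ^ 2 / τ by field_simp; norm_num]
    field_simp
  rw [key, mul_pow, cpow_half_pow_four]

lemma theta4_pow_S (τ : ℍ) : theta4 (S • τ : ℍ) ^ 4 = -(τ : ℂ) ^ 2 * theta2 τ ^ 4 := by
  have h := theta2_pow_S (S • τ)
  have hSS : S • S • τ = τ := by
    ext
    rw [coe_S_smul, coe_S_smul]
    field_simp
  rw [hSS] at h
  rw [h, coe_S_smul]
  have := τ.ne_zero
  field_simp

lemma differentiableAt_theta3 {z : ℂ} (hz : 0 < z.im) : DifferentiableAt ℂ theta3 z :=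
  differentiableAt_jacobiTheta hz

lemma differentiableAt_theta4 {z : ℂ} (hz : 0 < z.im) : DifferentiableAt ℂ theta4 z := by
  have : DifferentiableAt ℂ jacobiTheta (z + 1) := differentiableAt_jacobiTheta (by simpa using hz)
  exact this.comp z (by fun_prop)

lemma differentiableAt_theta2 {z : ℂ} (hz : 0 < z.im) : DifferentiableAt ℂ theta2 z := by
  have h4 : 0 < (z / 4).im := by
    rw [show z / 4 = z / (4 : ℝ) by norm_num, Complex.div_ofReal_im]; positivity
  have h1 : DifferentiableAt ℂ (fun w ↦ theta3 (w / 4) - theta3 w) z :=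
    ((differentiableAt_theta3 h4).comp z (by fun_prop)).sub (differentiableAt_theta3 hz)
  refine h1.congr_of_eventuallyEq ?_
  filter_upwards [isOpen_upperHalfPlaneSet.mem_nhds hz] with w hw
  exact theta2_eq_sub hw

lemma tendsto_theta3 : Tendsto theta3 (comap Complex.im atTop) (𝓝 1) := by
  have h : Tendsto (fun τ ↦ jacobiTheta τ - 1) (comap Complex.im atTop) (𝓝 0) := by
    refine isBigO_at_im_infty_jacobiTheta_sub_one.trans_tendsto ?_
    refine (Real.tendsto_exp_atBot.comp ?_).comp tendsto_comap
    exact tendsto_id.const_mul_atTop_of_neg (by linarith [Real.pi_pos])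
  simpa [theta3, Function.comp_def] using! h.add_const 1

lemma tendsto_theta4 : Tendsto theta4 (comap Complex.im atTop) (𝓝 1) := by
  refine tendsto_theta3.comp (tendsto_comap_iff.mpr ?_)
  simpa [Function.comp_def] using (tendsto_comap : Tendsto Complex.im _ atTop)

lemma tendsto_theta2 : Tendsto theta2 (comap Complex.im atTop) (𝓝 0) := by
  have h4 : Tendsto (fun z : ℂ ↦ z / 4) (comap Complex.im atTop) (comap Complex.im atTop) := by
    refine tendsto_comap_iff.mpr ?_
    have : (Complex.im ∘ fun z : ℂ ↦ z / 4) = fun z : ℂ ↦ z.im / 4 := by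
      ext z
      rw [Function.comp_apply, show z / 4 = z / (4 : ℝ) by norm_num, Complex.div_ofReal_im]
    rw [this]
    exact tendsto_comap.atTop_div_const (by norm_num)
  have := (tendsto_theta3.comp h4).sub tendsto_theta3
  rw [sub_self] at this
  refine this.congr' ?_
  filter_upwards [preimage_mem_comap (Ioi_mem_atTop 0)] with z hz
  exact (theta2_eq_sub hz).symm

/-! ### Holomorphic functions on the upper half-plane -/

lemma mdifferentiable_coe_of_differentiableAt {F : ℂ → ℂ}
    (hF : ∀ z : ℂ, 0 < z.im → DifferentiableAt ℂ F z) : MDiff (fun τ : ℍ ↦ F τ) := by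
  rw [UpperHalfPlane.mdifferentiable_iff]
  refine DifferentiableOn.congr (f := F)
    (fun z hz ↦ (hF z hz).differentiableWithinAt) fun z hz ↦ ?_
  simp [ofComplex_apply_of_im_pos hz]

lemma eq_zero_or_eq_zero_of_forall_mul_eq_zero {f g : ℍ → ℂ} (hf : MDiff f) (hg : MDiff g)
    (hfg : ∀ τ, f τ * g τ = 0) : (∀ τ, f τ = 0) ∨ (∀ τ, g τ = 0) := by
  rw [UpperHalfPlane.mdifferentiable_iff] at hf hg
  have := (hf.analyticOnNhd isOpen_upperHalfPlaneSet).eq_zero_or_eq_zero_of_mul_eq_zero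
    (hg.analyticOnNhd isOpen_upperHalfPlaneSet) (fun z _ ↦ hfg _)
    (Complex.isConnected_of_upperHalfPlane subset_rfl (by grind)).isPreconnected
  refine this.imp (fun h τ ↦ ?_) (fun h τ ↦ ?_) <;> simpa using h τ τ.im_pos

lemma periodic_comp_ofComplex_of_T {f : ℍ → ℂ} (hf : ∀ τ : ℍ, f (T • τ) = f τ) :
    Function.Periodic (f ∘ ofComplex) (1 : ℝ) := by
  intro w
  by_cases! hw : 0 < w.im
  · have h2 : 0 < (w + (1 : ℝ)).im := by simpa using hw
    simp only [Function.comp_apply]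
    rw [← hf (ofComplex w)]
    congr 1
    ext
    rw [coe_T_smul, ofComplex_apply_of_im_pos h2, ofComplex_apply_of_im_pos hw]
    simp
  -- Off the upper half-plane `ofComplex` takes a constant default value, so periodicity is trivial
  -- there.
  · have h2 : (w + (1 : ℝ)).im ≤ 0 := by simpa using hw
    simp only [Function.comp_apply, ofComplex_apply_of_im_nonpos h2,
      ofComplex_apply_of_im_nonpos hw]

lemma periodic_two_comp_ofComplex_of_T {f : ℍ → ℂ} (hf : ∀ τ : ℍ, f (T • T • τ) = f τ) :
    Function.Periodic (f ∘ ofComplex) (2 : ℝ) := by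
  intro w
  by_cases! hw : 0 < w.im
  · have h2 : 0 < (w + (2 : ℝ)).im := by simpa using hw
    simp only [Function.comp_apply]
    rw [← hf (ofComplex w)]
    congr 1
    ext
    rw [coe_T_smul, coe_T_smul, ofComplex_apply_of_im_pos h2, ofComplex_apply_of_im_pos hw]
    push_cast
    ring
  · have h2 : (w + (2 : ℝ)).im ≤ 0 := by simpa using hw
    simp only [Function.comp_apply, ofComplex_apply_of_im_nonpos h2,
      ofComplex_apply_of_im_nonpos hw]

/-- A holomorphic function of period two that vanishes at `i∞` decays like `exp (π i τ)`. -/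
lemma isBigO_exp_of_period_two {f : ℍ → ℂ} (hf : MDiff f) (hper : ∀ τ : ℍ, f (T • T • τ) = f τ)
    (h0 : Tendsto f atImInfty (𝓝 0)) :
    f =O[atImInfty] fun τ ↦ Real.exp (-2 * π * τ.im / 2) :=
  IsZeroAtImInfty.exp_decay_atImInfty (f := f) h0 two_pos (periodic_two_comp_ofComplex_of_T hper) hf
    (IsZeroAtImInfty.isBoundedAtImInfty h0)

/-- The derivative of a holomorphic function with a limit at `i∞` tends to zero there. -/
lemma tendsto_normalizedDeriv_atImInfty {f : ℍ → ℂ} (hf : MDiff f) {c : ℂ}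
    (hc : Tendsto f atImInfty (𝓝 c)) : Tendsto (D f) atImInfty (𝓝 0) := by
  suffices h : Tendsto (fun τ : ℍ ↦ deriv (f ∘ ofComplex) τ) atImInfty (𝓝 0) by
    rw [← mul_zero (2 * π * I : ℂ)⁻¹]
    exact h.const_mul _
  rw [UpperHalfPlane.mdifferentiable_iff] at hf
  rw [Metric.tendsto_nhds]
  intro ε hε
  have h1 := (Metric.tendsto_nhds.mp hc) (ε / 2) (by positivity)
  obtain ⟨A, hA⟩ := (atImInfty_mem _).mp h1
  -- Cauchy's estimate on the unit disc around τ; the margin 2 keeps the closed disc inside ℍ and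
  -- above height A.
  refine (atImInfty_mem _).mpr ⟨max A 0 + 2, fun τ hτ ↦ ?_⟩
  have hball : ∀ z ∈ Metric.closedBall (τ : ℂ) 1, max A 0 < z.im := by
    intro z hz
    have h2 : |(z - τ).im| ≤ 1 := (Complex.abs_im_le_norm _).trans (by simpa [dist_eq_norm] using hz)
    have h3 := (abs_le.mp h2).1
    simp only [Complex.sub_im, UpperHalfPlane.coe_im] at h3
    linarith
  have hd : DiffContOnCl ℂ (fun z ↦ (f ∘ ofComplex) z - c) (Metric.ball (τ : ℂ) 1) := by
    refine DifferentiableOn.diffContOnCl ?_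
    rw [closure_ball _ one_ne_zero]
    exact (hf.mono fun z hz ↦ (le_max_right A 0).trans_lt (hball z hz)).sub_const c
  have := Complex.norm_deriv_le_of_forall_mem_sphere_norm_le one_pos hd (C := ε / 2) fun z hz ↦ by
    have hz' := hball z (Metric.sphere_subset_closedBall hz)
    have h0 : 0 < z.im := (le_max_right A 0).trans_lt hz'
    have := hA ⟨z, h0⟩ ((le_max_left A 0).trans hz'.le)
    rw [Function.comp_apply, ofComplex_apply_of_im_pos h0, ← dist_eq_norm]
    exact this.le
  rw [deriv_sub_const] at this
  rw [Set.mem_ofPred_eq, dist_zero_right]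
  exact this.trans_lt (by linarith)

/-! ### Fourth powers of theta constants -/

/-- `θ₂⁴` on the upper half-plane. -/
noncomputable def fourthTheta2 (τ : ℍ) : ℂ := theta2 τ ^ 4

/-- `θ₃⁴` on the upper half-plane. -/
noncomputable def fourthTheta3 (τ : ℍ) : ℂ := theta3 τ ^ 4

/-- `θ₄⁴` on the upper half-plane. -/
noncomputable def fourthTheta4 (τ : ℍ) : ℂ := theta4 τ ^ 4

local notation "ϑ₂" => fourthTheta2
local notation "ϑ₃" => fourthTheta3
local notation "ϑ₄" => fourthTheta4

lemma fourthTheta2_S (τ : ℍ) : ϑ₂ (S • τ) = (τ : ℂ) ^ 2 * -ϑ₄ τ := by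
  rw [fourthTheta2, theta2_pow_S, fourthTheta4]; ring

lemma fourthTheta3_S (τ : ℍ) : ϑ₃ (S • τ) = (τ : ℂ) ^ 2 * -ϑ₃ τ := by
  rw [fourthTheta3, theta3_pow_S, fourthTheta3]; ring

lemma fourthTheta4_S (τ : ℍ) : ϑ₄ (S • τ) = (τ : ℂ) ^ 2 * -ϑ₂ τ := by
  rw [fourthTheta4, theta4_pow_S, fourthTheta2]; ring

lemma fourthTheta2_T (τ : ℍ) : ϑ₂ (T • τ) = -ϑ₂ τ := by
  rw [fourthTheta2, coe_T_smul, theta2_pow_add_one, fourthTheta2]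

lemma fourthTheta3_T (τ : ℍ) : ϑ₃ (T • τ) = ϑ₄ τ := by
  rw [fourthTheta3, coe_T_smul, theta3, fourthTheta4, theta4]

lemma fourthTheta4_T (τ : ℍ) : ϑ₄ (T • τ) = ϑ₃ τ := by
  rw [fourthTheta4, coe_T_smul, theta4_add_one, fourthTheta3]

lemma mdifferentiable_fourthTheta2 : MDiff ϑ₂ :=
  mdifferentiable_coe_of_differentiableAt (F := fun z ↦ theta2 z ^ 4)
    fun _ hz ↦ (differentiableAt_theta2 hz).pow 4

lemma mdifferentiable_fourthTheta3 : MDiff ϑ₃ :=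
  mdifferentiable_coe_of_differentiableAt (F := fun z ↦ theta3 z ^ 4)
    fun _ hz ↦ (differentiableAt_theta3 hz).pow 4

lemma mdifferentiable_fourthTheta4 : MDiff ϑ₄ :=
  mdifferentiable_coe_of_differentiableAt (F := fun z ↦ theta4 z ^ 4)
    fun _ hz ↦ (differentiableAt_theta4 hz).pow 4

lemma tendsto_fourthTheta2 : Tendsto ϑ₂ atImInfty (𝓝 0) := by
  simpa using! (tendsto_theta2.comp tendsto_coe_atImInfty).pow 4

lemma tendsto_fourthTheta3 : Tendsto ϑ₃ atImInfty (𝓝 1) := by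
  simpa using! (tendsto_theta3.comp tendsto_coe_atImInfty).pow 4

lemma tendsto_fourthTheta4 : Tendsto ϑ₄ atImInfty (𝓝 1) := by
  simpa using! (tendsto_theta4.comp tendsto_coe_atImInfty).pow 4

/-- Jacobi's identity `θ₂⁴ + θ₄⁴ = θ₃⁴`. -/
lemma fourthTheta2_add_fourthTheta4 (τ : ℍ) : ϑ₂ τ + ϑ₄ τ = ϑ₃ τ := by
  -- T changes the sign of the linear combination, and S changes it up to the factor τ²; only its
  -- square has level one.
  have hd : MDiff (fun τ ↦ (ϑ₂ τ + ϑ₄ τ - ϑ₃ τ) ^ 2) :=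
    ((mdifferentiable_fourthTheta2.add mdifferentiable_fourthTheta4).sub
      mdifferentiable_fourthTheta3).pow 2
  have hlim := ((tendsto_fourthTheta2.add tendsto_fourthTheta4).sub tendsto_fourthTheta3).pow 2
  have := eq_zero_of_weight_lt_twelve (k := 4) (by norm_num) hd
    (fun τ ↦ by
      simp only [fourthTheta2_S, fourthTheta3_S, fourthTheta4_S]
      norm_cast
      ring)
    (fun τ ↦ by
      simp only [fourthTheta2_T, fourthTheta3_T, fourthTheta4_T]
      ring) (by simpa using hlim) τ
  linear_combination pow_eq_zero_iff (two_ne_zero) |>.mp this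

lemma exists_sq_mul_eq_discriminant :
    ∃ c : ℂ, ∀ τ, (ϑ₂ τ * ϑ₃ τ * ϑ₄ τ) ^ 2 = c * discriminant τ := by
  have hd : MDiff (fun τ ↦ (ϑ₂ τ * ϑ₃ τ * ϑ₄ τ) ^ 2) :=
    ((mdifferentiable_fourthTheta2.mul mdifferentiable_fourthTheta3).mul
      mdifferentiable_fourthTheta4).pow 2
  have hlim := ((tendsto_fourthTheta2.mul tendsto_fourthTheta3).mul tendsto_fourthTheta4).pow 2
  obtain ⟨c, hc⟩ := CuspForm.exists_smul_discriminant_of_weight_eq_twelve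
    (cuspFormOfGenerators (k := 12) _ hd
      (fun τ ↦ by
        simp only [fourthTheta2_S, fourthTheta3_S, fourthTheta4_S]
        norm_cast
        ring)
      (fun τ ↦ by
        simp only [fourthTheta2_T, fourthTheta3_T, fourthTheta4_T]
        ring) (by simpa using hlim))
  refine ⟨c, fun τ ↦ ?_⟩
  have := congrArg (fun g : CuspForm 𝒮ℒ 12 ↦ g τ) hc
  exact this.symm

/-- The squared product is a multiple of Δ, which has no zeros on ℍ. The multiple is nonzero:
otherwise one factor would vanish identically, hence θ₄⁴ too by S and T, against its limit 1. -/
lemma fourthTheta_mul_ne_zero (τ : ℍ) : ϑ₂ τ * ϑ₃ τ * ϑ₄ τ ≠ 0 := by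
  obtain ⟨c, hc⟩ := exists_sq_mul_eq_discriminant
  have h4 : ¬ ∀ τ, ϑ₄ τ = 0 := fun h ↦
    zero_ne_one (tendsto_nhds_unique (tendsto_const_nhds.congr fun τ ↦ (h τ).symm)
      tendsto_fourthTheta4)
  have hc0 : c ≠ 0 := by
    rintro rfl
    have h0 : ∀ τ, ϑ₂ τ * ϑ₃ τ * ϑ₄ τ = 0 := fun τ ↦ by simpa using hc τ
    rcases eq_zero_or_eq_zero_of_forall_mul_eq_zero
      (mdifferentiable_fourthTheta2.mul mdifferentiable_fourthTheta3)
      mdifferentiable_fourthTheta4 h0 with h | h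
    · rcases eq_zero_or_eq_zero_of_forall_mul_eq_zero mdifferentiable_fourthTheta2
        mdifferentiable_fourthTheta3 h with h | h
      · refine h4 fun τ ↦ ?_
        simpa [h, τ.ne_zero] using fourthTheta2_S τ
      · refine h4 fun τ ↦ ?_
        rw [← fourthTheta3_T, h]
    · exact h4 h
  intro h
  have := hc τ
  rw [h] at this
  simp [hc0, discriminant_ne_zero] at this

lemma fourthTheta2_ne_zero (τ : ℍ) : ϑ₂ τ ≠ 0 :=
  left_ne_zero_of_mul (left_ne_zero_of_mul (fourthTheta_mul_ne_zero τ))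

lemma fourthTheta3_ne_zero (τ : ℍ) : ϑ₃ τ ≠ 0 :=
  right_ne_zero_of_mul (left_ne_zero_of_mul (fourthTheta_mul_ne_zero τ))

lemma fourthTheta4_ne_zero (τ : ℍ) : ϑ₄ τ ≠ 0 :=
  right_ne_zero_of_mul (fourthTheta_mul_ne_zero τ)

/-! ### Eisenstein series at the cusp -/

lemma tendsto_atImInfty_of_hasSum_qExpansion {f : ℍ → ℂ} {c : ℕ → ℂ} (hf : MDiff f)
    (hper : Function.Periodic (f ∘ ofComplex) (1 : ℝ))
    (hc : ∀ τ : ℍ, HasSum (fun m ↦ c m • Function.Periodic.qParam 1 τ ^ m) (f τ)) :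
    Tendsto f atImInfty (𝓝 (c 0)) := by
  have hb := isBoundedAtImInfty_of_hasSum_qExpansion one_pos hc
  have han := analyticAt_cuspFunction_zero one_pos hper hf hb
  have h1 := han.continuousAt.tendsto.comp (qParam_tendsto_atImInfty one_pos)
  have h2 : (cuspFunction 1 f ∘ fun τ : ℍ ↦ Function.Periodic.qParam 1 τ) = f := by
    funext τ
    simpa using eq_cuspFunction τ one_ne_zero hper
  have h3 := (hasFPowerSeriesOnBall_cuspFunction one_pos han hc).coeff_zero ![]
  rw [h2, ← h3] at h1
  simpa using h1

lemma E2_T (τ : ℍ) : E2 (T • τ) = E2 τ := by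
  rw [← slash_T_apply 2 E2, E2_slash_action, D2_T]
  simp

lemma tendsto_E2 : Tendsto E2 atImInfty (𝓝 1) := by
  have := tendsto_atImInfty_of_hasSum_qExpansion E2_mdifferentiable
    (periodic_comp_ofComplex_of_T E2_T)
    (c := fun m ↦ (if m = 0 then 1 else -24 * ArithmeticFunction.sigma 1 m : ℂ))
    (fun τ ↦ by simpa only [Function.Periodic.qParam, ofReal_one, div_one]
      using hasSum_qExpansion_E2 (z := τ))
  simpa using this

lemma tendsto_E₄ : Tendsto E₄ atImInfty (𝓝 1) := by
  have hper := SlashInvariantFormClass.periodic_comp_ofComplex E₄ (h := 1)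
    one_mem_strictPeriods_SL
  have hb := ModularFormClass.bdd_at_infty E₄
  have := tendsto_atImInfty_of_hasSum_qExpansion E₄.holo' hper
    (fun τ ↦ hasSum_qExpansion one_pos hper E₄.holo' hb τ)
  rwa [E_qExpansion_coeff_zero (by norm_num) (by decide)] at this

/-! ### Differential equations for the theta constants and for `E₂` -/

lemma serreDerivative_neg (k : ℂ) {f : ℍ → ℂ} (hf : MDiff f) :
    serreDerivative k (-f) = -serreDerivative k f := by
  simpa using serreDerivative_smul k (-1) f hf

lemma serreDerivative_two_S {f g : ℍ → ℂ} (hf : MDiff f) (hg : MDiff g)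
    (hfg : ∀ τ : ℍ, f (S • τ) = (τ : ℂ) ^ 2 * -g τ) (τ : ℍ) :
    serreDerivative 2 f (S • τ) = (τ : ℂ) ^ 4 * -serreDerivative 2 g τ := by
  have h1 : f ∣[(2 : ℤ)] S = -g := slash_S_eq fun τ ↦ by exact_mod_cast hfg τ
  have h2 := serreDerivative_slash_equivariant (k := 2) hf (γ := S)
  rw [h1, Int.cast_ofNat, serreDerivative_neg _ hg] at h2
  exact_mod_cast apply_S_of_slash h2 τ

lemma serreDerivative_two_T {f g : ℍ → ℂ} (hf : MDiff f)
    (hfg : ∀ τ : ℍ, f (T • τ) = g τ) (τ : ℍ) :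
    serreDerivative 2 f (T • τ) = serreDerivative 2 g τ := by
  have h1 : f ∣[(2 : ℤ)] T = g := slash_T_eq hfg
  have h2 := serreDerivative_slash_equivariant (k := 2) hf (γ := T)
  rw [h1, Int.cast_ofNat] at h2
  rw [← h2, slash_T_apply]

lemma tendsto_serreDerivative_two {f : ℍ → ℂ} (hf : MDiff f) {c : ℂ}
    (hc : Tendsto f atImInfty (𝓝 c)) :
    Tendsto (serreDerivative 2 f) atImInfty (𝓝 (-(c / 6))) := by
  have := (tendsto_normalizedDeriv_atImInfty hf hc).sub
    ((tendsto_E2.const_mul (2 * 12⁻¹ : ℂ)).mul hc)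
  rw [show (0 : ℂ) - 2 * 12⁻¹ * 1 * c = -(c / 6) by ring] at this
  exact this

/-- The defect of the differential equation for `θ₂⁴`. -/
noncomputable def thetaDefect2 (τ : ℍ) : ℂ :=
  serreDerivative 2 ϑ₂ τ - ϑ₂ τ * (ϑ₃ τ + ϑ₄ τ) / 6

/-- The defect of the differential equation for `θ₃⁴`. -/
noncomputable def thetaDefect3 (τ : ℍ) : ℂ :=
  serreDerivative 2 ϑ₃ τ - ϑ₃ τ * (ϑ₂ τ - ϑ₄ τ) / 6

/-- The defect of the differential equation for `θ₄⁴`. -/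
noncomputable def thetaDefect4 (τ : ℍ) : ℂ :=
  serreDerivative 2 ϑ₄ τ + ϑ₄ τ * (ϑ₂ τ + ϑ₃ τ) / 6

lemma thetaDefect2_S (τ : ℍ) : thetaDefect2 (S • τ) = (τ : ℂ) ^ 4 * -thetaDefect4 τ := by
  unfold thetaDefect2 thetaDefect4
  rw [serreDerivative_two_S mdifferentiable_fourthTheta2 mdifferentiable_fourthTheta4
    fourthTheta2_S, fourthTheta2_S, fourthTheta3_S, fourthTheta4_S]
  ring

lemma thetaDefect3_S (τ : ℍ) : thetaDefect3 (S • τ) = (τ : ℂ) ^ 4 * -thetaDefect3 τ := by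
  unfold thetaDefect3
  rw [serreDerivative_two_S mdifferentiable_fourthTheta3 mdifferentiable_fourthTheta3
    fourthTheta3_S, fourthTheta2_S, fourthTheta3_S, fourthTheta4_S]
  ring

lemma thetaDefect4_S (τ : ℍ) : thetaDefect4 (S • τ) = (τ : ℂ) ^ 4 * -thetaDefect2 τ := by
  unfold thetaDefect2 thetaDefect4
  rw [serreDerivative_two_S mdifferentiable_fourthTheta4 mdifferentiable_fourthTheta2
    fourthTheta4_S, fourthTheta2_S, fourthTheta3_S, fourthTheta4_S]
  ring

lemma thetaDefect2_T (τ : ℍ) : thetaDefect2 (T • τ) = -thetaDefect2 τ := by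
  unfold thetaDefect2
  rw [serreDerivative_two_T (g := -ϑ₂) mdifferentiable_fourthTheta2 fourthTheta2_T,
    serreDerivative_neg _ mdifferentiable_fourthTheta2,
    fourthTheta2_T, fourthTheta3_T, fourthTheta4_T, Pi.neg_apply]
  ring

lemma thetaDefect3_T (τ : ℍ) : thetaDefect3 (T • τ) = thetaDefect4 τ := by
  unfold thetaDefect3 thetaDefect4
  rw [serreDerivative_two_T mdifferentiable_fourthTheta3 fourthTheta3_T,
    fourthTheta2_T, fourthTheta3_T, fourthTheta4_T]
  ring

lemma thetaDefect4_T (τ : ℍ) : thetaDefect4 (T • τ) = thetaDefect3 τ := by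
  unfold thetaDefect3 thetaDefect4
  rw [serreDerivative_two_T mdifferentiable_fourthTheta4 fourthTheta4_T,
    fourthTheta2_T, fourthTheta3_T, fourthTheta4_T]
  ring

lemma mdifferentiable_thetaDefect2 : MDiff thetaDefect2 := by
  have := (serreDerivative_mdifferentiable 2 mdifferentiable_fourthTheta2).sub
    ((mdifferentiable_fourthTheta2.mul (mdifferentiable_fourthTheta3.add
      mdifferentiable_fourthTheta4)).mul (mdifferentiable_const (c := (6 : ℂ)⁻¹)))
  exact this

lemma mdifferentiable_thetaDefect3 : MDiff thetaDefect3 := by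
  have := (serreDerivative_mdifferentiable 2 mdifferentiable_fourthTheta3).sub
    ((mdifferentiable_fourthTheta3.mul (mdifferentiable_fourthTheta2.sub
      mdifferentiable_fourthTheta4)).mul (mdifferentiable_const (c := (6 : ℂ)⁻¹)))
  exact this

lemma mdifferentiable_thetaDefect4 : MDiff thetaDefect4 := by
  have := (serreDerivative_mdifferentiable 2 mdifferentiable_fourthTheta4).add
    ((mdifferentiable_fourthTheta4.mul (mdifferentiable_fourthTheta2.add
      mdifferentiable_fourthTheta3)).mul (mdifferentiable_const (c := (6 : ℂ)⁻¹)))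
  exact this

lemma tendsto_thetaDefect2 : Tendsto thetaDefect2 atImInfty (𝓝 0) := by
  have := (tendsto_serreDerivative_two mdifferentiable_fourthTheta2 tendsto_fourthTheta2).sub
    ((tendsto_fourthTheta2.mul (tendsto_fourthTheta3.add tendsto_fourthTheta4)).div_const 6)
  rw [show -((0 : ℂ) / 6) - 0 * (1 + 1) / 6 = 0 by norm_num] at this
  exact this

lemma tendsto_thetaDefect3 : Tendsto thetaDefect3 atImInfty (𝓝 0) := by
  have := (tendsto_serreDerivative_two mdifferentiable_fourthTheta3 tendsto_fourthTheta3).sub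
    ((tendsto_fourthTheta3.mul (tendsto_fourthTheta2.sub tendsto_fourthTheta4)).div_const 6)
  rw [show -((1 : ℂ) / 6) - 1 * (0 - 1) / 6 = 0 by norm_num] at this
  exact this

lemma tendsto_thetaDefect4 : Tendsto thetaDefect4 atImInfty (𝓝 0) := by
  have := (tendsto_serreDerivative_two mdifferentiable_fourthTheta4 tendsto_fourthTheta4).add
    ((tendsto_fourthTheta4.mul (tendsto_fourthTheta2.add tendsto_fourthTheta3)).div_const 6)
  rw [show -((1 : ℂ) / 6) + 1 * (0 + 1) / 6 = 0 by norm_num] at this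
  exact this

/-- The last two defects have period 2 and vanish at i∞, so each is O(exp(-π Im τ)). Their product
is therefore O(Δ), and the first defect supplies the extra decay. -/
lemma tendsto_thetaDefect_mul_div : Tendsto
    (fun τ ↦ thetaDefect2 τ * (thetaDefect3 τ * thetaDefect4 τ) / discriminant τ)
    atImInfty (𝓝 0) := by
  have h3 := isBigO_exp_of_period_two mdifferentiable_thetaDefect3
    (fun τ ↦ by rw [thetaDefect3_T, thetaDefect4_T]) tendsto_thetaDefect3
  have h4 := isBigO_exp_of_period_two mdifferentiable_thetaDefect4
    (fun τ ↦ by rw [thetaDefect4_T, thetaDefect3_T]) tendsto_thetaDefect4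
  have h34 : (fun τ ↦ thetaDefect3 τ * thetaDefect4 τ) =O[atImInfty] discriminant := by
    refine ((h3.mul h4).congr_right fun τ ↦ ?_).trans exp_isBigO_discriminant
    rw [← Real.exp_add]
    congr 1
    ring
  have h2 : thetaDefect2 =o[atImInfty] (fun _ ↦ (1 : ℂ)) :=
    (isLittleO_one_iff ℂ).mpr tendsto_thetaDefect2
  have := h2.mul_isBigO h34
  simp only [one_mul] at this
  exact this.tendsto_div_nhds_zero

/-- S and T permute the defects up to sign and the factor τ⁴, so the square of their product over Δ
has level one and weight 0. It vanishes at i∞, hence everywhere. -/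
lemma thetaDefect_mul_eq_zero (τ : ℍ) :
    thetaDefect2 τ * (thetaDefect3 τ * thetaDefect4 τ) = 0 := by
  have hd : MDiff (fun τ ↦
      (thetaDefect2 τ * (thetaDefect3 τ * thetaDefect4 τ) / discriminant τ) ^ 2) :=
    ((mdifferentiable_thetaDefect2.mul (mdifferentiable_thetaDefect3.mul
      mdifferentiable_thetaDefect4)).div mdifferentiable_discriminant discriminant_ne_zero).pow 2
  have := eq_zero_of_weight_lt_twelve (k := 0) (by norm_num) hd
    (fun τ ↦ by
      have := τ.ne_zero
      have := discriminant_ne_zero τ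
      simp only [thetaDefect2_S, thetaDefect3_S, thetaDefect4_S, discriminant_apply_S]
      field_simp)
    (fun τ ↦ by
      simp only [thetaDefect2_T, thetaDefect3_T, thetaDefect4_T, discriminant_apply_T]
      ring) (by simpa using tendsto_thetaDefect_mul_div.pow 2) τ
  simpa [discriminant_ne_zero] using this

/-- By the identity theorem one factor of the vanishing product is identically zero, and S and T
carry this to the other two. -/
lemma thetaDefect_eq_zero :
    (∀ τ, thetaDefect2 τ = 0) ∧ (∀ τ, thetaDefect3 τ = 0) ∧ (∀ τ, thetaDefect4 τ = 0) := by
  have h24 : (∀ τ, thetaDefect2 τ = 0) → ∀ τ, thetaDefect4 τ = 0 := fun h τ ↦ by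
    simpa [h, τ.ne_zero] using thetaDefect2_S τ
  have h42 : (∀ τ, thetaDefect4 τ = 0) → ∀ τ, thetaDefect2 τ = 0 := fun h τ ↦ by
    simpa [h, τ.ne_zero] using thetaDefect4_S τ
  have h43 : (∀ τ, thetaDefect4 τ = 0) → ∀ τ, thetaDefect3 τ = 0 := fun h τ ↦ by
    rw [← thetaDefect4_T, h]
  have h34 : (∀ τ, thetaDefect3 τ = 0) → ∀ τ, thetaDefect4 τ = 0 := fun h τ ↦ by
    rw [← thetaDefect3_T, h]
  have h4 : ∀ τ, thetaDefect4 τ = 0 := by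
    rcases eq_zero_or_eq_zero_of_forall_mul_eq_zero mdifferentiable_thetaDefect2
      (mdifferentiable_thetaDefect3.mul mdifferentiable_thetaDefect4)
      thetaDefect_mul_eq_zero with h | h
    · exact h24 h
    · exact (eq_zero_or_eq_zero_of_forall_mul_eq_zero mdifferentiable_thetaDefect3
        mdifferentiable_thetaDefect4 h).elim h34 id
  exact ⟨h42 h4, h43 h4, h4⟩

lemma E₄_S (τ : ℍ) : E₄ (S • τ) = (τ : ℂ) ^ (4 : ℤ) * E₄ τ :=
  apply_S_of_slash (SlashInvariantForm.slash_action_eqn E₄ _ ⟨S, rfl⟩) τ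

lemma E₄_T (τ : ℍ) : E₄ (T • τ) = E₄ τ := by
  rw [← slash_T_apply 4 E₄]
  exact congrFun (SlashInvariantForm.slash_action_eqn E₄ _ ⟨T, rfl⟩) τ

/-- `E₄ = (θ₂⁸ + θ₃⁸ + θ₄⁸) / 2`. -/
lemma E₄_eq_theta (τ : ℍ) : E₄ τ = (ϑ₂ τ ^ 2 + ϑ₃ τ ^ 2 + ϑ₄ τ ^ 2) / 2 := by
  have hd : MDiff (fun τ : ℍ ↦ (E₄ τ - (ϑ₂ τ ^ 2 + ϑ₃ τ ^ 2 + ϑ₄ τ ^ 2) * 2⁻¹ : ℂ)) :=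
    E₄.holo'.sub ((((mdifferentiable_fourthTheta2.pow 2).add
      (mdifferentiable_fourthTheta3.pow 2)).add (mdifferentiable_fourthTheta4.pow 2)).mul
      mdifferentiable_const)
  have hlim := tendsto_E₄.sub ((((tendsto_fourthTheta2.pow 2).add
    (tendsto_fourthTheta3.pow 2)).add (tendsto_fourthTheta4.pow 2)).mul_const 2⁻¹)
  rw [show (1 : ℂ) - (0 ^ 2 + 1 ^ 2 + 1 ^ 2) * 2⁻¹ = 0 by norm_num] at hlim
  have := eq_zero_of_weight_lt_twelve (k := 4) (by norm_num) hd
    (fun τ ↦ by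
      simp only [fourthTheta2_S, fourthTheta3_S, fourthTheta4_S, E₄_S]
      norm_cast
      ring)
    (fun τ ↦ by
      simp only [fourthTheta2_T, fourthTheta3_T, fourthTheta4_T, E₄_T]
      ring) hlim τ
  linear_combination this

lemma E2_S (τ : ℍ) : E2 (S • τ) = (τ : ℂ) ^ 2 * E2 τ + 6 * τ / (π * I) := by
  have h1 := apply_S_of_slash (E2_slash_action S) τ
  have hτ := τ.ne_zero
  have hpi : (π : ℂ) ≠ 0 := by exact_mod_cast Real.pi_ne_zero
  rw [h1]
  simp only [Pi.sub_apply, Pi.smul_apply, D2, denom_S, riemannZeta_two, smul_eq_mul]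
  simp [ModularGroup.S]
  field_simp
  ring_nf
  simp
  ring

/-- Two computations of D(E₂|S) are compared: direct differentiation of E₂ + 6/(πiτ), and the
general rule for the derivative of a slashed function. -/
lemma normalizedDeriv_E2_S (τ : ℍ) :
    D E2 (S • τ) = (τ : ℂ) ^ 4 * D E2 τ + (τ : ℂ) ^ 3 * E2 τ / (π * I) + 3 * τ ^ 2 / (π * I) ^ 2 := by
  have hτ := τ.ne_zero
  have hpi : (π : ℂ) ≠ 0 := by exact_mod_cast Real.pi_ne_zero
  have hslash : E2 ∣[(2 : ℤ)] S = fun τ : ℍ ↦ E2 τ + 6 / (π * I) * (τ : ℂ)⁻¹ :=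
    slash_S_eq fun τ ↦ by
      have := τ.ne_zero
      rw [E2_S]
      norm_cast
      field_simp
  have hE : HasDerivAt (E2 ∘ ofComplex) (deriv (E2 ∘ ofComplex) τ) τ :=
    (UpperHalfPlane.mdifferentiableAt_iff.mp (E2_mdifferentiable τ)).hasDerivAt
  have hder : D (E2 ∣[(2 : ℤ)] S) τ = D E2 τ + 3 / (π * I) ^ 2 * -((τ : ℂ) ^ 2)⁻¹ := by
    have h1 : HasDerivAt (fun z : ℂ ↦ (E2 ∘ ofComplex) z + 6 / (π * I) * z⁻¹)
        (deriv (E2 ∘ ofComplex) τ + 6 / (π * I) * -((τ : ℂ) ^ 2)⁻¹) τ :=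
      hE.add ((hasDerivAt_inv hτ).const_mul _)
    have h2 : (E2 ∣[(2 : ℤ)] S) ∘ ofComplex =ᶠ[𝓝 (τ : ℂ)]
        fun z : ℂ ↦ (E2 ∘ ofComplex) z + 6 / (π * I) * z⁻¹ := by
      filter_upwards [isOpen_upperHalfPlaneSet.mem_nhds τ.im_pos] with w hw
      simp [hslash, ofComplex_apply_of_im_pos hw]
    rw [normalizedDerivOfComplex, (h1.congr_of_eventuallyEq h2).deriv, normalizedDerivOfComplex]
    field_simp
    ring
  have h3 := congrFun (normalizedDerivOfComplex_SL_slash (k := 2) E2_mdifferentiable (γ := S)) τ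
  rw [hder] at h3
  have h4 := apply_S_of_slash (f := D E2) (k := 2 + 2) rfl τ
  have hS10 : ((S : SL(2, ℤ)) 1 0 : ℂ) = 1 := by simp [ModularGroup.S]
  rw [Pi.sub_apply, hslash, denom_S, hS10] at h3
  rw [h4]
  rw [eq_comm, sub_eq_iff_eq_add] at h3
  rw [h3]
  norm_cast
  push_cast
  field_simp
  ring

lemma normalizedDeriv_T {f : ℍ → ℂ} (hf : MDiff f) (hT : ∀ τ : ℍ, f (T • τ) = f τ) (τ : ℍ) :
    D f (T • τ) = D f τ := by
  have h1 : f ∣[(0 : ℤ)] T = f := slash_T_eq hT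
  have h2 := congrFun (normalizedDerivOfComplex_SL_slash (k := 0) hf (γ := T)) τ
  rw [h1] at h2
  simp only [Int.cast_zero, zero_mul, Pi.sub_apply, sub_zero] at h2
  rw [h2, slash_T_apply]

/-- Ramanujan's differential equation `D E₂ = (E₂² - E₄) / 12`. -/
lemma normalizedDeriv_E2 (τ : ℍ) : D E2 τ = (E2 τ ^ 2 - E₄ τ) / 12 := by
  have hd : MDiff (fun τ : ℍ ↦ (D E2 τ - (E2 τ ^ 2 - E₄ τ) * 12⁻¹ : ℂ)) :=
    (normalizedDerivOfComplex_mdifferentiable E2_mdifferentiable).sub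
      (((E2_mdifferentiable.pow 2).sub E₄.holo').mul mdifferentiable_const)
  have hlim := (tendsto_normalizedDeriv_atImInfty E2_mdifferentiable tendsto_E2).sub
    (((tendsto_E2.pow 2).sub tendsto_E₄).mul_const 12⁻¹)
  rw [show (0 : ℂ) - (1 ^ 2 - 1) * 12⁻¹ = 0 by norm_num] at hlim
  have := eq_zero_of_weight_lt_twelve (k := 4) (by norm_num) hd
    -- The non-modular terms in E₂ and τ produced by D E₂ and by E₂²/12 under S cancel.
    (fun τ ↦ by
      have hpi : (π : ℂ) ≠ 0 := by exact_mod_cast Real.pi_ne_zero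
      rw [normalizedDeriv_E2_S, E2_S, E₄_S]
      norm_cast
      field_simp
      ring)
    (fun τ ↦ by
      rw [normalizedDeriv_T E2_mdifferentiable E2_T, E2_T, E₄_T]) hlim τ
  linear_combination this

/-! ### The differential ring generated by `θ₂⁴`, `θ₄⁴` and `E₂` -/

lemma deriv_comp_ofComplex (f : ℍ → ℂ) (τ : ℍ) :
    deriv (f ∘ ofComplex) τ = 2 * π * I * D f τ := by
  have hpi : (π : ℂ) ≠ 0 := by exact_mod_cast Real.pi_ne_zero
  rw [normalizedDerivOfComplex]
  field_simp

lemma hasDerivAt_of_eqOn_upperHalfPlane {f : ℍ → ℂ} (hf : MDiff f) {F : ℂ → ℂ}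
    (hF : ∀ τ : ℍ, F τ = f τ) (τ : ℍ) : HasDerivAt F (2 * π * I * D f τ) τ := by
  have h1 : HasDerivAt (f ∘ ofComplex) (2 * π * I * D f τ) τ := by
    rw [← deriv_comp_ofComplex]
    exact (UpperHalfPlane.mdifferentiableAt_iff.mp (hf τ)).hasDerivAt
  refine h1.congr_of_eventuallyEq ?_
  filter_upwards [isOpen_upperHalfPlaneSet.mem_nhds τ.im_pos] with w hw
  rw [Function.comp_apply, ofComplex_apply_of_im_pos hw]
  exact hF ⟨w, hw⟩

/-- `E₂`, extended to a function on the complex plane. -/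
noncomputable def eisenstein2 (z : ℂ) : ℂ := E2 (ofComplex z)

lemma theta_jacobi {z : ℂ} (hz : 0 < z.im) : theta3 z ^ 4 = theta2 z ^ 4 + theta4 z ^ 4 :=
  (fourthTheta2_add_fourthTheta4 ⟨z, hz⟩).symm

lemma theta2_pow_ne_zero {z : ℂ} (hz : 0 < z.im) : theta2 z ^ 4 ≠ 0 := fourthTheta2_ne_zero ⟨z, hz⟩

lemma theta3_pow_ne_zero {z : ℂ} (hz : 0 < z.im) : theta3 z ^ 4 ≠ 0 := fourthTheta3_ne_zero ⟨z, hz⟩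

lemma theta4_pow_ne_zero {z : ℂ} (hz : 0 < z.im) : theta4 z ^ 4 ≠ 0 := fourthTheta4_ne_zero ⟨z, hz⟩

lemma hasDerivAt_theta2_pow {z : ℂ} (hz : 0 < z.im) :
    HasDerivAt (fun z ↦ theta2 z ^ 4) (π * I / 3 * (theta2 z ^ 4 *
      (eisenstein2 z + theta2 z ^ 4 + 2 * theta4 z ^ 4))) z := by
  have h := hasDerivAt_of_eqOn_upperHalfPlane mdifferentiable_fourthTheta2
    (F := fun z ↦ theta2 z ^ 4) (fun _ ↦ rfl) ⟨z, hz⟩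
  have h0 := thetaDefect_eq_zero.1 ⟨z, hz⟩
  rw [thetaDefect2, serreDerivative_apply, ← fourthTheta2_add_fourthTheta4] at h0
  convert h using 1
  simp only [eisenstein2, ofComplex_apply_of_im_pos hz]
  simp only [fourthTheta2, fourthTheta4] at h0 ⊢
  linear_combination -(2 * π * I) * h0

lemma hasDerivAt_theta4_pow {z : ℂ} (hz : 0 < z.im) :
    HasDerivAt (fun z ↦ theta4 z ^ 4) (π * I / 3 * (theta4 z ^ 4 *
      (eisenstein2 z - 2 * theta2 z ^ 4 - theta4 z ^ 4))) z := by
  have h := hasDerivAt_of_eqOn_upperHalfPlane mdifferentiable_fourthTheta4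
    (F := fun z ↦ theta4 z ^ 4) (fun _ ↦ rfl) ⟨z, hz⟩
  have h0 := thetaDefect_eq_zero.2.2 ⟨z, hz⟩
  rw [thetaDefect4, serreDerivative_apply, ← fourthTheta2_add_fourthTheta4] at h0
  convert h using 1
  simp only [eisenstein2, ofComplex_apply_of_im_pos hz]
  simp only [fourthTheta2, fourthTheta4] at h0 ⊢
  linear_combination -(2 * π * I) * h0

lemma E₄_eq_of_im_pos (τ : ℍ) : E₄ τ =
    (theta2 τ ^ 4) ^ 2 + theta2 τ ^ 4 * theta4 τ ^ 4 + (theta4 τ ^ 4) ^ 2 := by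
  rw [E₄_eq_theta, ← fourthTheta2_add_fourthTheta4, fourthTheta2, fourthTheta4]
  ring

lemma hasDerivAt_eisenstein2 {z : ℂ} (hz : 0 < z.im) :
    HasDerivAt eisenstein2 (π * I / 6 * (eisenstein2 z ^ 2 -
      ((theta2 z ^ 4) ^ 2 + theta2 z ^ 4 * theta4 z ^ 4 + (theta4 z ^ 4) ^ 2))) z := by
  have h := hasDerivAt_of_eqOn_upperHalfPlane E2_mdifferentiable
    (F := eisenstein2) (fun _ ↦ by simp [eisenstein2]) ⟨z, hz⟩
  convert h using 1
  rw [normalizedDeriv_E2, E₄_eq_of_im_pos]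
  simp only [eisenstein2, ofComplex_apply_of_im_pos hz]
  ring

/-! ### Schwarz derivative of a function with a Riccati equation -/

/-- If `f' = W`, `W' = W φ` and `φ' = φ² / 2 + s` then the Schwarz derivative of `f` is `s`. -/
lemma schwarzian_eq_of_riccati {f W φ s : ℂ → ℂ} {V : Set ℂ} (hV : IsOpen V)
    (hf : ∀ z ∈ V, HasDerivAt f (W z) z) (hW : ∀ z ∈ V, HasDerivAt W (W z * φ z) z)
    (hφ : ∀ z ∈ V, HasDerivAt φ (φ z ^ 2 / 2 + s z) z) {z : ℂ} (hz : z ∈ V) (h0 : W z ≠ 0) :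
    schwarzian f z = s z := by
  have h1 : ∀ z ∈ V, deriv f z = W z := fun z hz ↦ (hf z hz).deriv
  have h2 : ∀ z ∈ V, iteratedDeriv 2 f z = W z * φ z := fun z hz ↦ by
    rw [iteratedDeriv_succ, iteratedDeriv_one]
    refine (Filter.EventuallyEq.deriv_eq ?_).trans (hW z hz).deriv
    filter_upwards [hV.mem_nhds hz] using h1
  have h3 : iteratedDeriv 3 f z = W z * φ z * φ z + W z * (φ z ^ 2 / 2 + s z) := by
    rw [iteratedDeriv_succ]
    refine (Filter.EventuallyEq.deriv_eq ?_).trans ((hW z hz).mul (hφ z hz)).deriv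
    filter_upwards [hV.mem_nhds hz] using h2
  rw [schwarzian, h1 z hz, h2 z hz, h3]
  field_simp
  ring

/-! ### The function `h` in terms of theta constants -/

/-- The denominator of `h`, multiplied by `θ₃¹⁶`. -/
noncomputable def thetaDen (z : ℂ) : ℂ :=
  (theta2 z ^ 4) ^ 4 + 2 * (theta2 z ^ 4) ^ 3 * theta4 z ^ 4 -
    4 * theta2 z ^ 4 * (theta4 z ^ 4) ^ 3 - 2 * (theta4 z ^ 4) ^ 4

/-- The numerator of `h`, multiplied by `θ₃¹⁶`. -/
noncomputable def thetaNum (z : ℂ) : ℂ :=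
  -((theta2 z ^ 4) ^ 3 * (theta2 z ^ 4 + 2 * theta4 z ^ 4))

/-- The Serre derivative of `thetaDen`, up to a constant factor. -/
noncomputable def thetaDenSerre (z : ℂ) : ℂ :=
  4 * (theta2 z ^ 4) ^ 5 + 10 * (theta2 z ^ 4) ^ 4 * theta4 z ^ 4 +
    10 * (theta2 z ^ 4) ^ 3 * (theta4 z ^ 4) ^ 2 + 20 * (theta2 z ^ 4) ^ 2 * (theta4 z ^ 4) ^ 3 +
    20 * theta2 z ^ 4 * (theta4 z ^ 4) ^ 4 + 8 * (theta4 z ^ 4) ^ 5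

/-- The derivative of `h` in terms of theta constants. -/
noncomputable def thetaDeriv (z : ℂ) : ℂ :=
  12 * π * I * (theta2 z ^ 4 * theta4 z ^ 4 * (theta2 z ^ 4 + theta4 z ^ 4)) ^ 3 / thetaDen z ^ 2

/-- The logarithmic derivative of `h'` in terms of theta constants and `E₂`. -/
noncomputable def thetaLogDeriv (z : ℂ) : ℂ :=
  π * I / 3 * (eisenstein2 z - 2 * thetaDenSerre z / thetaDen z)

/-- With a' = (πi/3)a(E₂ + a + 2c) and c' = (πi/3)c(E₂ - 2a - c), a form of degree k in a, c yields
k·E₂ times itself plus a form of degree k + 1; here k = 4. -/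
lemma hasDerivAt_thetaDen {z : ℂ} (hz : 0 < z.im) : HasDerivAt thetaDen
    (π * I / 3 * (4 * eisenstein2 z * thetaDen z + thetaDenSerre z)) z := by
  have ha := hasDerivAt_theta2_pow hz
  have hc := hasDerivAt_theta4_pow hz
  refine HasDerivAt.congr_deriv (f := thetaDen)
    (((((ha.pow 4).add (((ha.pow 3).const_mul 2).mul hc)).sub
    ((ha.const_mul 4).mul (hc.pow 3))).sub ((hc.pow 4).const_mul 2))) ?_
  simp only [Pi.pow_apply, thetaDen, thetaDenSerre]
  push_cast
  ring

lemma hasDerivAt_thetaNum {z : ℂ} (hz : 0 < z.im) : HasDerivAt thetaNum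
    (π * I / 3 * (4 * eisenstein2 z * thetaNum z - 4 * (theta2 z ^ 4) ^ 5
      - 10 * (theta2 z ^ 4) ^ 4 * theta4 z ^ 4 - 10 * (theta2 z ^ 4) ^ 3 * (theta4 z ^ 4) ^ 2)) z := by
  have ha := hasDerivAt_theta2_pow hz
  have hc := hasDerivAt_theta4_pow hz
  refine HasDerivAt.congr_deriv (f := thetaNum)
    (((ha.pow 3).mul (ha.add (hc.const_mul 2))).neg) ?_
  simp only [Pi.pow_apply, Pi.add_apply, thetaNum]
  push_cast
  ring

/-- The part free of E₂, left here as the chain rule gives it, equals 20(a² + ac + c²)Q. -/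
lemma hasDerivAt_thetaDenSerre {z : ℂ} (hz : 0 < z.im) : HasDerivAt thetaDenSerre
    (π * I / 3 * (5 * eisenstein2 z * thetaDenSerre z +
      (theta2 z ^ 4 * (20 * (theta2 z ^ 4) ^ 4 + 40 * (theta2 z ^ 4) ^ 3 * theta4 z ^ 4 +
        30 * (theta2 z ^ 4) ^ 2 * (theta4 z ^ 4) ^ 2 + 40 * theta2 z ^ 4 * (theta4 z ^ 4) ^ 3 +
        20 * (theta4 z ^ 4) ^ 4) * (theta2 z ^ 4 + 2 * theta4 z ^ 4) -
      theta4 z ^ 4 * (10 * (theta2 z ^ 4) ^ 4 + 20 * (theta2 z ^ 4) ^ 3 * theta4 z ^ 4 +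
        60 * (theta2 z ^ 4) ^ 2 * (theta4 z ^ 4) ^ 2 + 80 * theta2 z ^ 4 * (theta4 z ^ 4) ^ 3 +
        40 * (theta4 z ^ 4) ^ 4) * (2 * theta2 z ^ 4 + theta4 z ^ 4)))) z := by
  have ha := hasDerivAt_theta2_pow hz
  have hc := hasDerivAt_theta4_pow hz
  refine HasDerivAt.congr_deriv (f := thetaDenSerre)
    (((((((ha.pow 5).const_mul 4).add (((ha.pow 4).const_mul 10).mul hc)).add
    (((ha.pow 3).const_mul 10).mul (hc.pow 2))).add
    (((ha.pow 2).const_mul 20).mul (hc.pow 3))).add ((ha.const_mul 20).mul (hc.pow 4))).add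
    ((hc.pow 5).const_mul 8)) ?_
  simp only [Pi.pow_apply, thetaDenSerre]
  push_cast
  ring

lemma hasDerivAt_thetaNum_div {z : ℂ} (hz : 0 < z.im) (hd : thetaDen z ≠ 0) :
    HasDerivAt (fun z ↦ thetaNum z / thetaDen z) (thetaDeriv z) z := by
  refine HasDerivAt.congr_deriv (f := (fun z ↦ thetaNum z / thetaDen z))
    ((hasDerivAt_thetaNum hz).div (hasDerivAt_thetaDen hz) hd) ?_
  -- N and Q have equal degree, so the E₂ terms cancel in N'Q - NQ'; what is left is
  -- (πi/3)·36(abc)³.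
  rw [thetaDeriv]
  congr 1
  unfold thetaNum thetaDen thetaDenSerre
  ring

lemma hasDerivAt_thetaDeriv {z : ℂ} (hz : 0 < z.im) (hd : thetaDen z ≠ 0) :
    HasDerivAt thetaDeriv (thetaDeriv z * thetaLogDeriv z) z := by
  have ha := hasDerivAt_theta2_pow hz
  have hc := hasDerivAt_theta4_pow hz
  refine HasDerivAt.congr_deriv (f := thetaDeriv)
    (((((ha.mul hc).mul (ha.add hc)).pow 3).const_mul (12 * π * I : ℂ)).div
    ((hasDerivAt_thetaDen hz).pow 2) (pow_ne_zero 2 hd)) ?_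
  simp only [Pi.pow_apply, Pi.mul_apply, Pi.add_apply]
  unfold thetaDeriv thetaLogDeriv
  -- The forms of Q and ψ play no role here: abc has logarithmic derivative πi·E₂, and that of Q is
  -- (πi/3)(4E₂ + ψ/Q).
  generalize thetaDenSerre z = ψ
  generalize thetaDen z = d at *
  push_cast
  field_simp
  ring

lemma hasDerivAt_thetaLogDeriv {z : ℂ} (hz : 0 < z.im) (hd : thetaDen z ≠ 0) :
    HasDerivAt thetaLogDeriv (thetaLogDeriv z ^ 2 / 2 + 2 * π ^ 2 * (3 / 2) ^ 2 *
      ((theta2 z ^ 4) ^ 2 + theta2 z ^ 4 * theta4 z ^ 4 + (theta4 z ^ 4) ^ 2)) z := by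
  have hp := hasDerivAt_eisenstein2 hz
  refine HasDerivAt.congr_deriv (f := thetaLogDeriv)
    (((hp.sub (((hasDerivAt_thetaDenSerre hz).const_mul 2).div
    (hasDerivAt_thetaDen hz) hd)).const_mul (π * I / 3 : ℂ))) ?_
  unfold thetaLogDeriv
  field_simp
  rw [I_sq]
  -- The E₂ and ψ² terms form φ²/2. The rest is (πi/3)²(-1/2 - 40)E₄ = (9π²/2)E₄, where the 40 needs
  -- the explicit forms of Q and ψ.
  unfold thetaDen thetaDenSerre
  ring

lemma eval_denPoly (t : ℂ) : denPoly.eval t = t ^ 4 - 2 * t ^ 3 + 4 * t - 2 := by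
  simp [denPoly]

lemma eval_numPoly (t : ℂ) : numPoly.eval t = t ^ 3 * (t - 2) := by
  simp [numPoly]

lemma eval_denPoly_modularLambda {z : ℂ} (hz : 0 < z.im) :
    denPoly.eval (modularLambda z) = thetaDen z / (theta3 z ^ 4) ^ 4 := by
  have h3 := theta3_pow_ne_zero hz
  rw [eval_denPoly, modularLambda, thetaDen,
    show theta4 z ^ 4 = theta3 z ^ 4 - theta2 z ^ 4 by rw [theta_jacobi hz]; ring]
  generalize theta3 z ^ 4 = b at *
  field_simp
  ring

lemma eval_numPoly_modularLambda {z : ℂ} (hz : 0 < z.im) :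
    numPoly.eval (modularLambda z) = thetaNum z / (theta3 z ^ 4) ^ 4 := by
  have h3 := theta3_pow_ne_zero hz
  rw [eval_numPoly, modularLambda, thetaNum,
    show theta4 z ^ 4 = theta3 z ^ 4 - theta2 z ^ 4 by rw [theta_jacobi hz]; ring]
  generalize theta3 z ^ 4 = b at *
  field_simp
  ring

lemma eval_denPoly_ne_zero_iff {z : ℂ} (hz : 0 < z.im) :
    denPoly.eval (modularLambda z) ≠ 0 ↔ thetaDen z ≠ 0 := by
  rw [eval_denPoly_modularLambda hz]
  have := theta3_pow_ne_zero hz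
  simp_all

lemma h_eq_theta {z : ℂ} (hz : 0 < z.im) : h z = thetaNum z / thetaDen z := by
  have h3 := theta3_pow_ne_zero hz
  rw [h, eval_denPoly_modularLambda hz, eval_numPoly_modularLambda hz,
    div_div_div_cancel_right₀ (pow_ne_zero 4 h3)]

lemma h_eventuallyEq {z : ℂ} (hz : 0 < z.im) : h =ᶠ[𝓝 z] fun z ↦ thetaNum z / thetaDen z := by
  filter_upwards [isOpen_upperHalfPlaneSet.mem_nhds hz] with w hw
  exact h_eq_theta hw

lemma analyticAt_thetaDen {z : ℂ} (hz : 0 < z.im) : AnalyticAt ℂ thetaDen z :=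
  DifferentiableOn.analyticAt (s := {z | 0 < z.im})
    (fun _ hw ↦ (hasDerivAt_thetaDen hw).differentiableAt.differentiableWithinAt)
    (isOpen_upperHalfPlaneSet.mem_nhds hz)

lemma analyticAt_thetaNum {z : ℂ} (hz : 0 < z.im) : AnalyticAt ℂ thetaNum z :=
  DifferentiableOn.analyticAt (s := {z | 0 < z.im})
    (fun _ hw ↦ (hasDerivAt_thetaNum hw).differentiableAt.differentiableWithinAt)
    (isOpen_upperHalfPlaneSet.mem_nhds hz)

lemma meromorphicOn_h : MeromorphicOn h {z : ℂ | 0 < z.im} := fun _ hz ↦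
  ((analyticAt_thetaNum hz).meromorphicAt.div (analyticAt_thetaDen hz).meromorphicAt).congr
    ((h_eventuallyEq hz).symm.filter_mono nhdsWithin_le_nhds)

lemma analyticAt_h {z : ℂ} (hz : 0 < z.im) (hd : thetaDen z ≠ 0) : AnalyticAt ℂ h z :=
  ((analyticAt_thetaNum hz).div (analyticAt_thetaDen hz) hd).congr (h_eventuallyEq hz).symm

lemma hasDerivAt_h {z : ℂ} (hz : 0 < z.im) (hd : thetaDen z ≠ 0) :
    HasDerivAt h (thetaDeriv z) z :=
  (hasDerivAt_thetaNum_div hz hd).congr_of_eventuallyEq (h_eventuallyEq hz)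

lemma thetaDeriv_ne_zero {z : ℂ} (hz : 0 < z.im) (hd : thetaDen z ≠ 0) : thetaDeriv z ≠ 0 := by
  have h3 := theta3_pow_ne_zero hz
  rw [theta_jacobi hz] at h3
  have hpi : (π : ℂ) ≠ 0 := by exact_mod_cast Real.pi_ne_zero
  exact div_ne_zero (mul_ne_zero (by simp [hpi]) (pow_ne_zero 3 (mul_ne_zero
    (mul_ne_zero (theta2_pow_ne_zero hz) (theta4_pow_ne_zero hz)) h3))) (pow_ne_zero 2 hd)

lemma isOpen_thetaDen_ne_zero : IsOpen ({z : ℂ | 0 < z.im} ∩ thetaDen ⁻¹' {0}ᶜ) :=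
  ContinuousOn.isOpen_inter_preimage
    (fun _ hw ↦ (hasDerivAt_thetaDen hw).continuousAt.continuousWithinAt)
    isOpen_upperHalfPlaneSet isOpen_compl_singleton

lemma schwarzian_h {z : ℂ} (hz : 0 < z.im) (hd : thetaDen z ≠ 0) :
    schwarzian h z = 2 * π ^ 2 * (3 / 2) ^ 2 *
      ((theta2 z ^ 4) ^ 2 + theta2 z ^ 4 * theta4 z ^ 4 + (theta4 z ^ 4) ^ 2) :=
  schwarzian_eq_of_riccati isOpen_thetaDen_ne_zero (fun _ hw ↦ hasDerivAt_h hw.1 hw.2)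
    (fun _ hw ↦ hasDerivAt_thetaDeriv hw.1 hw.2) (fun _ hw ↦ hasDerivAt_thetaLogDeriv hw.1 hw.2)
    (s := fun z ↦ 2 * π ^ 2 * (3 / 2) ^ 2 *
      ((theta2 z ^ 4) ^ 2 + theta2 z ^ 4 * theta4 z ^ 4 + (theta4 z ^ 4) ^ 2))
    ⟨hz, hd⟩ (thetaDeriv_ne_zero hz hd)

lemma neBot_comap_im_atTop : (comap Complex.im atTop).NeBot :=
  atTop_neBot.comap_of_surj fun y ↦ ⟨⟨0, y⟩, rfl⟩

lemma tendsto_thetaDen : Tendsto thetaDen (comap Complex.im atTop) (𝓝 (-2)) := by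
  have ha := tendsto_theta2.pow 4
  have hc := tendsto_theta4.pow 4
  have := (((ha.pow 4).add (((ha.pow 3).const_mul 2).mul hc)).sub
    ((ha.const_mul 4).mul (hc.pow 3))).sub ((hc.pow 4).const_mul 2)
  norm_num at this
  simpa [thetaDen] using! this

/-- The poles of `h` are isolated. -/
lemma eventually_thetaDen_ne_zero {z : ℂ} (hz : 0 < z.im) : ∀ᶠ w in 𝓝[≠] z, thetaDen w ≠ 0 := by
  by_contra hcon
  have hfreq : ∃ᶠ w in 𝓝[≠] z, thetaDen w = 0 := hcon
  have hzero : Set.EqOn thetaDen 0 {z : ℂ | 0 < z.im} :=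
    AnalyticOnNhd.eqOn_zero_of_preconnected_of_frequently_eq_zero
      (fun w hw ↦ analyticAt_thetaDen hw)
      (Complex.isConnected_of_upperHalfPlane subset_rfl (by grind)).isPreconnected hz hfreq
  -- Were Q identically zero, its limit at i∞ would be 0 and not -2.
  have h0 : Tendsto thetaDen (comap Complex.im atTop) (𝓝 0) := by
    refine tendsto_const_nhds.congr' ?_
    filter_upwards [preimage_mem_comap (Ioi_mem_atTop 0)] with w hw
    exact (hzero hw).symm
  have := neBot_comap_im_atTop
  have := tendsto_nhds_unique h0 tendsto_thetaDen
  norm_num at this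

/-- The zeros of Q are isolated, so near any point, a pole included, the Schwarz derivative agrees
with a continuous function off that point. -/
lemma tendsto_schwarzian_h (τ : ℍ) : Tendsto (schwarzian h) (𝓝[≠] (τ : ℂ))
    (𝓝 (2 * (π : ℂ) ^ 2 * (3 / 2) ^ 2 * E₄ τ)) := by
  have ha := (hasDerivAt_theta2_pow τ.im_pos).continuousAt
  have hc := (hasDerivAt_theta4_pow τ.im_pos).continuousAt
  have hcont : ContinuousAt (fun z ↦ 2 * (π : ℂ) ^ 2 * (3 / 2) ^ 2 *
      ((theta2 z ^ 4) ^ 2 + theta2 z ^ 4 * theta4 z ^ 4 + (theta4 z ^ 4) ^ 2)) (τ : ℂ) :=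
    (((ha.pow 2).add (ha.mul hc)).add (hc.pow 2)).const_mul _
  rw [E₄_eq_of_im_pos]
  refine (hcont.tendsto.mono_left nhdsWithin_le_nhds).congr' ?_
  filter_upwards [eventually_thetaDen_ne_zero τ.im_pos,
    mem_nhdsWithin_of_mem_nhds (isOpen_upperHalfPlaneSet.mem_nhds τ.im_pos)] with w hw hw'
  exact (schwarzian_h hw' hw).symm

/-! ### The level of `h` -/

/-- The functions `θ₂⁴`, `θ₄⁴` and `-θ₃⁴`, indexed by the nonzero vectors of `𝔽₂²`, which the
modular group permutes up to a common factor. -/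
noncomputable def thetaVector (v : Fin 2 → ZMod 2) (τ : ℍ) : ℂ :=
  if v 0 = 0 then (if v 1 = 0 then 0 else theta2 τ ^ 4)
  else (if v 1 = 0 then theta4 τ ^ 4 else -theta3 τ ^ 4)

/-- `γ` acts on `thetaVector`, up to a nonzero factor, through its reduction modulo 2. -/
def PermutesTheta (γ : SL(2, ℤ)) : Prop :=
  ∀ τ : ℍ, ∃ μ : ℂ, μ ≠ 0 ∧ ∀ v : Fin 2 → ZMod 2, thetaVector v (γ • τ) =
    μ * thetaVector (Matrix.vecMul v (γ.1.map (Int.cast : ℤ → ZMod 2))) τ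

lemma permutesTheta_one : PermutesTheta 1 := fun τ ↦ ⟨1, one_ne_zero, fun v ↦ by simp⟩

lemma PermutesTheta.mul {γ δ : SL(2, ℤ)} (hγ : PermutesTheta γ) (hδ : PermutesTheta δ) :
    PermutesTheta (γ * δ) := fun τ ↦ by
  obtain ⟨μ, hμ, h1⟩ := hγ (δ • τ)
  obtain ⟨ν, hν, h2⟩ := hδ τ
  refine ⟨μ * ν, mul_ne_zero hμ hν, fun v ↦ ?_⟩
  rw [mul_smul, h1, h2, Matrix.vecMul_vecMul, mul_assoc]
  have : (γ * δ).1.map (Int.cast : ℤ → ZMod 2) =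
      γ.1.map (Int.cast : ℤ → ZMod 2) * δ.1.map (Int.cast : ℤ → ZMod 2) :=
    Matrix.map_mul (f := Int.castRingHom (ZMod 2))
  rw [this]

lemma PermutesTheta.inv {γ : SL(2, ℤ)} (hγ : PermutesTheta γ) : PermutesTheta γ⁻¹ := fun τ ↦ by
  obtain ⟨μ, hμ, h1⟩ := hγ (γ⁻¹ • τ)
  refine ⟨μ⁻¹, inv_ne_zero hμ, fun v ↦ ?_⟩
  have h2 := h1 (Matrix.vecMul v (γ⁻¹.1.map (Int.cast : ℤ → ZMod 2)))
  have : (γ⁻¹).1.map (Int.cast : ℤ → ZMod 2) * γ.1.map (Int.cast : ℤ → ZMod 2) = 1 := by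
    have h3 : (γ⁻¹ * γ).1.map (Int.cast : ℤ → ZMod 2) =
      γ⁻¹.1.map (Int.cast : ℤ → ZMod 2) * γ.1.map (Int.cast : ℤ → ZMod 2) :=
      Matrix.map_mul (f := Int.castRingHom (ZMod 2))
    rw [← h3]
    simp
  rw [smul_inv_smul, Matrix.vecMul_vecMul, this, Matrix.vecMul_one] at h2
  rw [h2, inv_mul_cancel_left₀ hμ]

lemma permutesTheta_S : PermutesTheta S := fun τ ↦ by
  refine ⟨-(τ : ℂ) ^ 2, neg_ne_zero.mpr (pow_ne_zero 2 τ.ne_zero), fun v ↦ ?_⟩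
  have h0 : Matrix.vecMul v (S.1.map (Int.cast : ℤ → ZMod 2)) 0 = v 1 := by
    simp [ModularGroup.S, Matrix.vecMul, dotProduct]
  have h1 : Matrix.vecMul v (S.1.map (Int.cast : ℤ → ZMod 2)) 1 = v 0 := by
    simp [ModularGroup.S, Matrix.vecMul, dotProduct]
  simp only [thetaVector, h0, h1, theta2_pow_S, theta3_pow_S, theta4_pow_S]
  split_ifs <;> ring

lemma zmod_two_eq_zero_or_one : ∀ x : ZMod 2, x = 0 ∨ x = 1 := by decide

lemma permutesTheta_T : PermutesTheta T := fun τ ↦ by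
  refine ⟨-1, by norm_num, fun v ↦ ?_⟩
  have h0 : Matrix.vecMul v (T.1.map (Int.cast : ℤ → ZMod 2)) 0 = v 0 := by
    simp [ModularGroup.T, Matrix.vecMul, dotProduct]
  have h1 : Matrix.vecMul v (T.1.map (Int.cast : ℤ → ZMod 2)) 1 = v 0 + v 1 := by
    simp [ModularGroup.T, Matrix.vecMul, dotProduct]
  simp only [thetaVector, h0, h1, coe_T_smul, theta2_pow_add_one, theta4_add_one,
    show theta3 (τ + 1) = theta4 τ from rfl]
  have h11 : (1 : ZMod 2) + 1 = 0 := by decide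
  rcases zmod_two_eq_zero_or_one (v 0) with hx | hx <;>
    rcases zmod_two_eq_zero_or_one (v 1) with hy | hy <;> simp [hx, hy, h11]

/-- The property is stable under products and inverses, so the generators S and T suffice. -/
lemma permutesTheta (γ : SL(2, ℤ)) : PermutesTheta γ := by
  have : γ ∈ Subgroup.closure {S, T} := by
    rw [SpecialLinearGroup.SL2Z_generators]
    trivial
  induction this using Subgroup.closure_induction with
  | mem x hx =>
    rcases hx with rfl | rfl
    exacts [permutesTheta_S, permutesTheta_T]
  | one => exact permutesTheta_one
  | mul x y _ _ hx hy => exact hx.mul hy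
  | inv x _ hx => exact hx.inv

/-- The homogeneous form of the rational function that defines `h`. -/
noncomputable def homRatio (x y : ℂ) : ℂ :=
  x ^ 3 * (x - 2 * y) / (x ^ 4 - 2 * x ^ 3 * y + 4 * x * y ^ 3 - 2 * y ^ 4)

lemma homRatio_mul {μ : ℂ} (hμ : μ ≠ 0) (x y : ℂ) :
    homRatio (μ * x) (μ * y) = homRatio x y := by
  rw [homRatio, homRatio, ← mul_div_mul_left (x ^ 3 * (x - 2 * y)) _ (pow_ne_zero 4 hμ)]
  congr 1 <;> ring

lemma h_eq_homRatio {z : ℂ} (hz : 0 < z.im) : h z = homRatio (theta2 z ^ 4) (theta3 z ^ 4) := by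
  rw [h_eq_theta hz, theta_jacobi hz, thetaNum, thetaDen, homRatio]
  congr 1 <;> ring

lemma tendsto_homRatio {α : Type*} {l : Filter α} {f g : α → ℂ} {x y : ℂ}
    (hf : Tendsto f l (𝓝 x)) (hg : Tendsto g l (𝓝 y))
    (h0 : x ^ 4 - 2 * x ^ 3 * y + 4 * x * y ^ 3 - 2 * y ^ 4 ≠ 0) :
    Tendsto (fun t ↦ homRatio (f t) (g t)) l (𝓝 (homRatio x y)) :=
  ((hf.pow 3).mul (hf.sub (hg.const_mul 2))).div
    ((((hf.pow 4).sub (((hf.pow 3).const_mul 2).mul hg)).add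
      ((hf.const_mul 4).mul (hg.pow 3))).sub ((hg.pow 4).const_mul 2)) h0

/-- θ₂⁴ and -θ₃⁴ have indices (0,1) and (1,1), which γ sends to its bottom row and to the sum of its
rows modulo 2. At poles both sides are 0 by the convention for division. -/
lemma h_smul (γ : SL(2, ℤ)) (τ : ℍ) : h (γ • τ : ℍ) =
    homRatio (thetaVector ![(γ 1 0 : ZMod 2), (γ 1 1 : ZMod 2)] τ)
      (-thetaVector ![(γ 0 0 : ZMod 2) + γ 1 0, (γ 0 1 : ZMod 2) + γ 1 1] τ) := by
  obtain ⟨μ, hμ, hv⟩ := permutesTheta γ τ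
  have h2 : theta2 (γ • τ : ℍ) ^ 4 = thetaVector ![0, 1] (γ • τ) := by simp [thetaVector]
  have h3 : theta3 (γ • τ : ℍ) ^ 4 = -thetaVector ![1, 1] (γ • τ) := by simp [thetaVector]
  have w2 : Matrix.vecMul ![0, 1] (γ.1.map (Int.cast : ℤ → ZMod 2)) =
      ![(γ 1 0 : ZMod 2), (γ 1 1 : ZMod 2)] := by
    ext i; fin_cases i <;> simp [Matrix.vecMul, dotProduct]
  have w3 : Matrix.vecMul ![1, 1] (γ.1.map (Int.cast : ℤ → ZMod 2)) =
      ![(γ 0 0 : ZMod 2) + γ 1 0, (γ 0 1 : ZMod 2) + γ 1 1] := by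
    ext i; fin_cases i <;> simp [Matrix.vecMul, dotProduct]
  rw [h_eq_homRatio (γ • τ).im_pos, h2, h3, hv, hv, w2, w3, ← mul_neg, homRatio_mul hμ]

lemma tendsto_h : Tendsto (fun τ : ℍ ↦ h τ) atImInfty (𝓝 0) := by
  have := tendsto_homRatio tendsto_fourthTheta2 tendsto_fourthTheta3 (by norm_num)
  rw [show homRatio 0 1 = 0 by simp [homRatio]] at this
  refine this.congr fun τ ↦ ?_
  rw [h_eq_homRatio τ.im_pos, fourthTheta2, fourthTheta3]

/-- For the cosets of Γ(2) that move the cusp i∞: h tends to 0 there, while h∘γ has a nonzero limit.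
-/
lemma not_forall_homRatio_eq_h {f g : ℍ → ℂ} {x y : ℂ} (hf : Tendsto f atImInfty (𝓝 x))
    (hg : Tendsto g atImInfty (𝓝 y))
    (h0 : x ^ 4 - 2 * x ^ 3 * y + 4 * x * y ^ 3 - 2 * y ^ 4 ≠ 0)
    (h1 : x ^ 3 * (x - 2 * y) ≠ 0) : ¬ ∀ τ : ℍ, homRatio (f τ) (g τ) = h τ := fun hcon ↦ by
  have := tendsto_nhds_unique ((tendsto_homRatio hf hg h0).congr hcon) tendsto_h
  exact div_ne_zero h1 h0 this

/-- The coset of T fixes the cusp, so limits of h do not help. Instead h∘T = -h, and invariance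
would force N = 0 wherever Q ≠ 0, hence a + 2c = 0 near i∞, although a + 2c tends to 2. -/
lemma not_forall_homRatio_neg_eq_h :
    ¬ ∀ τ : ℍ, homRatio (fourthTheta2 τ) (-fourthTheta4 τ) = h τ := fun hcon ↦ by
  have hnum : ∀ᶠ τ : ℍ in atImInfty, fourthTheta2 τ + 2 * fourthTheta4 τ = 0 := by
    have hev : ∀ᶠ τ : ℍ in atImInfty, thetaDen τ ≠ 0 :=
      (tendsto_thetaDen.comp tendsto_coe_atImInfty).eventually_ne (by norm_num)
    filter_upwards [hev] with τ hτ
    have h1 := hcon τ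
    rw [h_eq_theta τ.im_pos] at h1
    have h2 : homRatio (fourthTheta2 τ) (-fourthTheta4 τ) = -(thetaNum τ / thetaDen τ) := by
      rw [homRatio, thetaNum, thetaDen, ← neg_div, fourthTheta2, fourthTheta4]
      congr 1 <;> ring
    have h3 : thetaNum τ / thetaDen τ = 0 := by
      linear_combination (h2 - h1) / 2
    have h4 : thetaNum τ = 0 := (div_eq_zero_iff.mp h3).resolve_right hτ
    rw [thetaNum, neg_eq_zero] at h4
    exact (mul_eq_zero.mp h4).resolve_left (pow_ne_zero 3 (theta2_pow_ne_zero τ.im_pos))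
  have h5 := tendsto_fourthTheta2.add (tendsto_fourthTheta4.const_mul 2)
  have h6 := tendsto_nhds_unique (tendsto_const_nhds.congr' (hnum.mono fun _ h ↦ h.symm)) h5
  norm_num at h6

lemma h_invariant_iff (γ : SL(2, ℤ)) :
    (∀ τ : ℍ, h (γ • τ : ℍ) = h τ) ↔ γ ∈ CongruenceSubgroup.Gamma 2 := by
  simp only [h_smul]
  rw [CongruenceSubgroup.Gamma_mem]
  have hdet : ((γ 0 0 : ZMod 2) * γ 1 1 - (γ 0 1 : ZMod 2) * γ 1 0) = 1 := by
    have := γ.2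
    rw [Matrix.det_fin_two] at this
    exact_mod_cast congrArg (Int.cast : ℤ → ZMod 2) this
  generalize (γ 0 0 : ZMod 2) = p at *
  generalize (γ 0 1 : ZMod 2) = q at *
  generalize (γ 1 0 : ZMod 2) = r at *
  generalize (γ 1 1 : ZMod 2) = s at *
  have t2 : Tendsto (fun τ : ℍ ↦ theta2 τ ^ 4) atImInfty (𝓝 0) := tendsto_fourthTheta2
  have t3 : Tendsto (fun τ : ℍ ↦ theta3 τ ^ 4) atImInfty (𝓝 1) := tendsto_fourthTheta3
  have t4 : Tendsto (fun τ : ℍ ↦ theta4 τ ^ 4) atImInfty (𝓝 1) := tendsto_fourthTheta4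
  have e43 := not_forall_homRatio_eq_h t4 t3 (by norm_num) (by norm_num)
  have e42 := not_forall_homRatio_eq_h t4 t2.neg (by norm_num) (by norm_num)
  have e34 := not_forall_homRatio_eq_h t3.neg t4.neg (by norm_num) (by norm_num)
  have e32 := not_forall_homRatio_eq_h t3.neg t2.neg (by norm_num) (by norm_num)
  have e24 := not_forall_homRatio_neg_eq_h
  have e23 : ∀ τ : ℍ, homRatio (theta2 τ ^ 4) (theta3 τ ^ 4) = h τ :=
    fun τ ↦ (h_eq_homRatio τ.im_pos).symm
  have h11 : (1 : ZMod 2) + 1 = 0 := by decide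
  -- Of the sixteen matrices over 𝔽₂ the determinant leaves the six in SL₂(𝔽₂); only the identity
  -- gives back h.
  rcases zmod_two_eq_zero_or_one p with rfl | rfl <;>
    rcases zmod_two_eq_zero_or_one q with rfl | rfl <;>
    rcases zmod_two_eq_zero_or_one r with rfl | rfl <;>
    rcases zmod_two_eq_zero_or_one s with rfl | rfl <;>
    simp [thetaVector, h11] at hdet ⊢
  exacts [not_forall.mp e43, not_forall.mp e34, e23, not_forall.mp e32, not_forall.mp e24,
    not_forall.mp e42]

open Polynomial in
lemma isCoprime_numPoly_denPoly : IsCoprime numPoly denPoly := by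
  -- The denominator minus the numerator is 4t - 2, and the numerator is -3/16 at t = 1/2. So 4t - 2
  -- divides 1 + (16/3)·numerator, with the cubic below as quotient.
  refine ⟨-C (16 / 3) - (C (4 / 3) * X ^ 3 - 2 * X ^ 2 - X - C (1 / 2)),
    C (4 / 3) * X ^ 3 - 2 * X ^ 2 - X - C (1 / 2), Polynomial.funext fun t ↦ ?_⟩
  simp only [eval_add, eval_mul, eval_numPoly, eval_denPoly, eval_sub, eval_neg, eval_C, eval_pow,
    eval_X, eval_ofNat, eval_one]
  ring

lemma max_natDegree : max numPoly.natDegree denPoly.natDegree = 4 := by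
  have hn : numPoly.natDegree = 4 := by
    unfold numPoly
    compute_degree!
  have hd : denPoly.natDegree = 4 := by
    unfold denPoly
    compute_degree!
  rw [hn, hd, max_self]

end SchwarzLambda

open SchwarzLambda in
theorem mainTheorem11 :
    -- `h` is a meromorphic function on the upper half-plane
    MeromorphicOn h {z : ℂ | 0 < z.im} ∧
    -- away from its poles, `h` is holomorphic with `h' ≠ 0` and `{h, τ} = 2 π² (3/2)² E₄(τ)`
    (∀ τ : UpperHalfPlane, denPoly.eval (modularLambda τ) ≠ 0 →
      AnalyticAt ℂ h τ ∧ deriv h τ ≠ 0 ∧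
      schwarzian h τ = 2 * (Real.pi : ℂ) ^ 2 * (3 / 2) ^ 2 * ModularForm.E₄ τ) ∧
    -- the equation holds at all points (the poles of `h` included) by continuous extension
    (∀ τ : UpperHalfPlane, Filter.Tendsto (schwarzian h) (nhdsWithin (τ : ℂ) {(τ : ℂ)}ᶜ)
      (nhds (2 * (Real.pi : ℂ) ^ 2 * (3 / 2) ^ 2 * ModularForm.E₄ τ))) ∧
    -- level `m = 2`: the elements of `SL(2, ℤ)` that leave `h` invariant are those of `Γ(2)`
    (∀ γ : Matrix.SpecialLinearGroup (Fin 2) ℤ,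
      (∀ τ : UpperHalfPlane, h ((γ • τ : UpperHalfPlane) : ℂ) = h (τ : ℂ)) ↔
        γ ∈ CongruenceSubgroup.Gamma 2) ∧
    -- degree `d = 4` of `h` as a rational function of `λ`
    IsCoprime numPoly denPoly ∧ max numPoly.natDegree denPoly.natDegree = 4 := by
  exact ⟨meromorphicOn_h,
    fun τ hτ ↦ by
      have hd := (eval_denPoly_ne_zero_iff τ.im_pos).mp hτ
      refine ⟨analyticAt_h τ.im_pos hd, ?_, ?_⟩
      · rw [(hasDerivAt_h τ.im_pos hd).deriv]
        exact thetaDeriv_ne_zero τ.im_pos hd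
      · rw [schwarzian_h τ.im_pos hd, E₄_eq_of_im_pos],
    tendsto_schwarzian_h, h_invariant_iff, isCoprime_numPoly_denPoly, max_natDegree⟩
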